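/- Let $(X,d)$ be a metric space. **Tight span.** $T(X)$ is the set of functions $f:X\to[0,\infty)$ with $f(x)=\sup_{y\in X}(d(x,y)-f(y))$ for all $x\in X$, with the metric $d_T(f,g)=\sup_{x\in X}|f(x)-g(x)|$. **Trimming.** For $x\in X$ put $\underline d(x)=\inf\{\tfrac12(d(x,y)+d(x,z)-d(y,z)) : y,z\in X\setminus\{x\},\ y\ne z\}$ if $X$ has at least three points, $\underline d(x)=\tfrac12 d(x,y)$ if $X=\{x,y\}$ has exactly two points, and $\underline d(x)=0$ if $X=\{x\}$. The formula $d^-(x,y)=d(x,y)-\underline d(x)-\underline d(y)$ for $x\neq y$, $d^-(x,x)=0$, defines a pseudometric in $X$; let $t(X)$ be the metric quotient of $(X,d^-)$, i.e. the metric space obtained by identifying points at distance $0$, and $p:X\to t(X)$ the projection. Set $(X_0,d_0)=(X,d)$ and $(X_{k+1},d_{k+1})=t(X_k)$, with projections $p_k:X_k\to X_{k+1}$. The map $g\mapsto g\circ p+\underline d$ is an embedding $T(t(X))\hookrightarrow T(X)$; composing such embeddings $T(X_n)\hookrightarrow T(X_{n-1})\hookrightarrow\cdots\hookrightarrow T(X)$,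 view each $T(X_n)$ as a subset of $T(X)$, and put $\tau=\bigcap_{n\ge1}T(X_n)\subset T(X)$. **Trimming cylinder.** $C$ is the graph with vertex set $\coprod_{k\ge0}X_k$ in which each $v\in X_k$, $k\ge 0$, is joined to $p_k(v)\in X_{k+1}$ by an edge $e_v$ of length $\underline{d_k}(v)\ge0$ (edges of length $0$ are allowed). All components of $C$ are trees; each of them carries the path pseudometric, in which the distance between two points is the sum of the lengths of the edges and subedges forming an injective path between them. A vertex $v\in X_k$ is special if all the edges $e_v, e_{p_k(v)}, e_{p_{k+1}(p_k(v))},\dots$ have length $0$. A component of $C$ is special if it contains a special vertex. **Theorem.** For every metric space $(X,d)$: 1. Among the pseudometrics in $C$ which restrict to $d$ in $X=X_0\subset C$ and to the path pseudometric in every component of $C$, there is a (pointwise) smallest one, $\rho$. Let $\overline C$ be the metric quotient of $(C,\rho)$. All special vertices of a special component of $C$ project to a single point of $\overline C$, called its root; let $\overline C_\bullet\subset\overline C$ be the set of the roots of all special components. 2. For $a\in C$, the function $f_a:X\to[0,\infty)$, $f_a(x)=\rho(x,a)$, belongs to $T(X)$, and $a\mapsto f_a$ induces a distance preserving map $\overline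 C\hookrightarrow T(X)$. 3. Viewing $\overline C$ as a subset of $T(X)$ via this embedding, $$T(X)=\tau\cup\overline C\qquad\text{and}\qquad \tau\cap\overline C=\overline C_\bullet .$$ -/

import Mathlib

open Set

namespace TightSpanTrimming

universe u

/-! ### The tight span -/

/-- The points of the tight span `T(X)` of a metric space: the functions `f : X → ℝ₊` such that
`f x = sup_y (d(x, y) - f y)` for all `x`. -/
structure TightSpan (X : Type u) [MetricSpace X] where
  toFun : X → ℝ
  nonneg' : ∀ x, 0 ≤ toFun x
  isLUB' : ∀ x, IsLUB (range fun y => dist x y - toFun y) (toFun x)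

namespace TightSpan

variable {X : Type u} [MetricSpace X]

instance : CoeFun (TightSpan X) (fun _ => X → ℝ) := ⟨toFun⟩

theorem ext_fun {f g : TightSpan X} (h : ∀ x, f x = g x) : f = g := by
  cases f; cases g
  congr
  exact funext h

theorem dist_le_add (f : TightSpan X) (x y : X) : dist x y ≤ f x + f y := by
  have h : dist x y - f y ≤ f x := (f.isLUB' x).1 ⟨y, rfl⟩
  linarith

theorem le_dist_add (f : TightSpan X) (x y : X) : f x ≤ dist x y + f y := by
  refine (f.isLUB' x).2 ?_
  rintro _ ⟨z, rfl⟩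
  have h1 := f.dist_le_add y z
  have h2 := dist_triangle x y z
  simp only
  linarith

theorem exists_add_le (f : TightSpan X) (x : X) {ε : ℝ} (hε : 0 < ε) :
    ∃ y, f x + f y ≤ dist x y + ε := by
  obtain ⟨_, ⟨y, rfl⟩, hy, -⟩ := (f.isLUB' x).exists_between (sub_lt_self (f x) hε)
  exact ⟨y, by linarith⟩

/-- A nonnegative function with `f x + f y ≥ d(x, y)` and, for all `x` and `ε > 0`,
`f x + f y ≤ d(x, y) + ε` for some `y`, is a point of the tight span. -/
def ofConditions (f : X → ℝ) (h0 : ∀ x, 0 ≤ f x) (h1 : ∀ x y, dist x y ≤ f x + f y)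
    (h2 : ∀ x (ε : ℝ), 0 < ε → ∃ y, f x + f y ≤ dist x y + ε) : TightSpan X where
  toFun := f
  nonneg' := h0
  isLUB' x := by
    constructor
    · rintro _ ⟨y, rfl⟩
      have := h1 x y
      simp only
      linarith
    · intro b hb
      refine le_of_forall_pos_le_add fun ε hε => ?_
      obtain ⟨y, hy⟩ := h2 x ε hε
      have h3 : dist x y - f y ≤ b := hb ⟨y, rfl⟩
      linarith

theorem bddAbove_abs_sub (f g : TightSpan X) : BddAbove (range fun x => |f x - g x|) := by
  rcases isEmpty_or_nonempty X with h | ⟨⟨w⟩⟩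
  · simp [range_eq_empty]
  · refine ⟨f w + g w, ?_⟩
    rintro _ ⟨x, rfl⟩
    have h1 := f.le_dist_add x w
    have h2 := g.le_dist_add x w
    have h3 := f.dist_le_add x w
    have h4 := g.dist_le_add x w
    simp only [abs_le]
    constructor <;> linarith

/-- The metric `d_T(f, g) = sup_x |f x - g x|` on the tight span. -/
noncomputable instance : MetricSpace (TightSpan X) where
  dist f g := ⨆ x, |f x - g x|
  dist_self f := by simp
  dist_comm f g := by simp only [abs_sub_comm]
  dist_triangle f g h := by
    rcases isEmpty_or_nonempty X with hX | hX
    · simp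
    · refine ciSup_le fun x => ?_
      have h1 := le_ciSup (bddAbove_abs_sub f g) x
      have h2 := le_ciSup (bddAbove_abs_sub g h) x
      have h3 := abs_sub_le (f x) (g x) (h x)
      linarith
  eq_of_dist_eq_zero {f g} h := by
    refine ext_fun fun x => ?_
    have h1 := le_ciSup (bddAbove_abs_sub f g) x
    have h2 : (⨆ x, |f x - g x|) = 0 := h
    simp only [h2] at h1
    exact sub_eq_zero.mp (abs_nonpos_iff.mp h1)

end TightSpan

/-! ### Trimming -/

section Trimming

variable (X : Type u) [MetricSpace X]

variable {X} in
/-- The Gromov product `d(x, y, z) = (d(x, y) + d(x, z) - d(y, z)) / 2`. -/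
noncomputable def gromovProduct (x y z : X) : ℝ := (dist x y + dist x z - dist y z) / 2

open Classical in
variable {X} in
/-- The function written `d` with an underline: if `X` has at least three points, the infimum of
the Gromov products `d(x, y, z)` over distinct `y, z ∈ X \ {x}`; if `X` has exactly two points, half
their distance; if `X` has only one point, zero. -/
noncomputable def underDist (x : X) : ℝ :=
  if ∃ y z : X, y ≠ x ∧ z ≠ x ∧ y ≠ z then
    sInf {r | ∃ y z : X, y ≠ x ∧ z ≠ x ∧ y ≠ z ∧ r = gromovProduct x y z}
  else if h : ∃ y : X, y ≠ x then dist x h.choose / 2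
  else 0

variable {X}

theorem gromovProduct_nonneg (x y z : X) : 0 ≤ gromovProduct x y z := by
  have := dist_triangle y x z
  rw [dist_comm y x] at this
  unfold gromovProduct
  linarith

theorem underDist_nonneg (x : X) : 0 ≤ underDist x := by
  unfold underDist
  split_ifs
  · refine Real.sInf_nonneg ?_
    rintro _ ⟨y, z, -, -, -, rfl⟩
    exact gromovProduct_nonneg x y z
  · positivity
  · exact le_rfl

theorem underDist_le {x y z : X} (hy : y ≠ x) (hz : z ≠ x) (hyz : y ≠ z) :
    underDist x ≤ gromovProduct x y z := by
  unfold underDist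
  rw [if_pos ⟨y, z, hy, hz, hyz⟩]
  refine csInf_le ⟨0, ?_⟩ ⟨y, z, hy, hz, hyz, rfl⟩
  rintro _ ⟨y, z, -, -, -, rfl⟩
  exact gromovProduct_nonneg x y z

theorem underDist_eq_half {x y : X} (hxy : y ≠ x) (h : ∀ z, z = x ∨ z = y) :
    underDist x = dist x y / 2 := by
  have h1 : ¬ ∃ y z : X, y ≠ x ∧ z ≠ x ∧ y ≠ z := by
    rintro ⟨a, b, ha, hb, hab⟩
    exact hab (((h a).resolve_left ha).trans ((h b).resolve_left hb).symm)
  have h2 : ∃ y : X, y ≠ x := ⟨y, hxy⟩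
  unfold underDist
  rw [if_neg h1, dif_pos h2, (h h2.choose).resolve_left h2.choose_spec]

theorem underDist_eq_zero {x : X} (h : ∀ z, z = x) : underDist x = 0 := by
  unfold underDist
  rw [if_neg, dif_neg]
  · rintro ⟨y, hy⟩
    exact hy (h y)
  · rintro ⟨y, z, hy, -⟩
    exact hy (h y)

theorem underDist_add_le {x y : X} (hxy : x ≠ y) : underDist x + underDist y ≤ dist x y := by
  by_cases h : ∃ z, z ≠ x ∧ z ≠ y
  · obtain ⟨z, hzx, hzy⟩ := h
    have h1 := underDist_le hxy.symm hzx hzy.symm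
    have h2 := underDist_le hxy hzy hzx.symm
    unfold gromovProduct at h1 h2
    rw [dist_comm y x] at h2
    linarith
  · push Not at h
    have h1 := underDist_eq_half hxy.symm fun z => or_iff_not_imp_left.mpr (h z)
    have h2 := underDist_eq_half hxy fun z => (or_iff_not_imp_left.mpr (h z)).symm
    rw [h1, h2, dist_comm y x]
    linarith

open Classical in
/-- The trimmed distance: `d(x, y)` minus the values of `underDist` at `x` and `y` for `x ≠ y`, and
zero for `x = y`. -/
noncomputable def trimDist (x y : X) : ℝ :=
  if x = y then 0 else dist x y - underDist x - underDist y

theorem trimDist_self (x : X) : trimDist x x = 0 := if_pos rfl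

theorem trimDist_of_ne {x y : X} (h : x ≠ y) :
    trimDist x y = dist x y - underDist x - underDist y := if_neg h

theorem trimDist_comm (x y : X) : trimDist x y = trimDist y x := by
  by_cases h : x = y
  · rw [h]
  · rw [trimDist_of_ne h, trimDist_of_ne (Ne.symm h), dist_comm]
    ring

theorem trimDist_nonneg (x y : X) : 0 ≤ trimDist x y := by
  by_cases h : x = y
  · rw [h, trimDist_self]
  · rw [trimDist_of_ne h]
    linarith [underDist_add_le h]

theorem trimDist_triangle (x y z : X) : trimDist x z ≤ trimDist x y + trimDist y z := by
  by_cases hxy : x = y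
  · rw [hxy, trimDist_self, zero_add]
  by_cases hyz : y = z
  · rw [hyz, trimDist_self, add_zero]
  by_cases hxz : x = z
  · rw [hxz, trimDist_self]
    exact add_nonneg (trimDist_nonneg _ _) (trimDist_nonneg _ _)
  have h := underDist_le hxy (Ne.symm hyz) hxz
  rw [trimDist_of_ne hxy, trimDist_of_ne hyz, trimDist_of_ne hxz]
  unfold gromovProduct at h
  rw [dist_comm y x] at h
  linarith

variable (X)

/-- The set `X`, to be equipped with the trimmed distance instead of its metric. -/
def PreTrim : Type u := X

noncomputable instance : PseudoMetricSpace (PreTrim X) where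
  dist x y := trimDist (X := X) x y
  dist_self := trimDist_self (X := X)
  dist_comm := trimDist_comm (X := X)
  dist_triangle := trimDist_triangle (X := X)

/-- The metric space `t(X)`: the metric quotient of `X` with the trimmed distance. -/
abbrev Trim : Type u := SeparationQuotient (PreTrim X)

variable {X}

/-- The trimming projection `X → t(X)`. -/
noncomputable def Trim.proj (x : X) : Trim X := SeparationQuotient.mk (X := PreTrim X) x

theorem Trim.proj_surjective : Function.Surjective (Trim.proj : X → Trim X) :=
  SeparationQuotient.surjective_mk (X := PreTrim X)

theorem Trim.dist_proj (x y : X) : dist (Trim.proj x) (Trim.proj y) = trimDist x y :=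
  SeparationQuotient.dist_mk (α := PreTrim X) x y

/-- The canonical embedding `T(t(X)) → T(X)`, which carries `g` to the function
`x ↦ g (p x) + underDist x`, where `p` is the trimming projection. -/
noncomputable def TightSpan.trimEmbed (g : TightSpan (Trim X)) : TightSpan X :=
  TightSpan.ofConditions (fun x => g (Trim.proj x) + underDist x)
    (fun x => add_nonneg (g.nonneg' _) (underDist_nonneg x))
    (by
      intro x y
      by_cases hxy : x = y
      · rw [hxy, dist_self]
        have h1 := g.nonneg' (Trim.proj y)
        have h2 := underDist_nonneg y
        linarith
      · have h := g.dist_le_add (Trim.proj x) (Trim.proj y)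
        rw [Trim.dist_proj, trimDist_of_ne hxy] at h
        linarith)
    (by
      intro x ε hε
      by_cases hx : ∃ z, z ≠ x
      · suffices h : ∃ y, x ≠ y ∧ g (Trim.proj x) + g (Trim.proj y) ≤
            dist (Trim.proj x) (Trim.proj y) + ε by
          obtain ⟨y, hxy, hy⟩ := h
          rw [Trim.dist_proj, trimDist_of_ne hxy] at hy
          exact ⟨y, by linarith⟩
        obtain ⟨q, hq⟩ := g.exists_add_le (Trim.proj x) hε
        obtain ⟨y, rfl⟩ := Trim.proj_surjective q
        by_cases hxy : x = y
        · obtain ⟨z, hz⟩ := hx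
          refine ⟨z, Ne.symm hz, ?_⟩
          have h := g.le_dist_add (Trim.proj z) (Trim.proj x)
          rw [← hxy, dist_self] at hq
          rw [dist_comm] at h
          linarith
        · exact ⟨y, hxy, hq⟩
      · push Not at hx
        obtain ⟨q, hq⟩ := g.exists_add_le (Trim.proj x) hε
        obtain ⟨y, rfl⟩ := Trim.proj_surjective q
        rw [hx y, dist_self] at hq
        refine ⟨x, ?_⟩
        rw [underDist_eq_zero hx, dist_self]
        linarith)

end Trimming

/-! ### The trimming sequence and the trimming filtration -/

section Sequence

/-- The metric spaces `X_0 = X` and `X_{k+1} = t(X_k)`, each bundled with its metric. -/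
noncomputable def stageBundle (X : Type u) [hX : MetricSpace X] : ℕ → (Y : Type u) × MetricSpace Y
  | 0 => ⟨X, hX⟩
  | k + 1 =>
    letI : MetricSpace (stageBundle X k).1 := (stageBundle X k).2
    ⟨Trim (stageBundle X k).1, inferInstance⟩

variable (X : Type u) [MetricSpace X]

/-- The underlying set of `X_k = t^k(X)`. -/
def Stage (k : ℕ) : Type u := (stageBundle X k).1

/-- The metric `d_k` of `X_k`. -/
noncomputable instance (k : ℕ) : MetricSpace (Stage X k) := (stageBundle X k).2

variable {X}

/-- The trimming projection `p_k : X_k → X_{k+1}`. -/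
noncomputable def stageProj (k : ℕ) (v : Stage X k) : Stage X (k + 1) :=
  Trim.proj (X := Stage X k) v

/-- The embedding `T(X_n) → T(X)`: the composition
`T(X_n) → T(X_{n-1}) → ⋯ → T(X_0) = T(X)` of the canonical embeddings. -/
noncomputable def stageEmbed : (n : ℕ) → TightSpan (Stage X n) → TightSpan X
  | 0 => fun f => f
  | n + 1 => fun f => stageEmbed n (TightSpan.trimEmbed (X := Stage X n) f)

variable (X) in
/-- The set `τ = ⋂_{n ≥ 1} T(X_n)`, where `T(X_n)` is viewed as a subset of `T(X)`. -/
def tau : Set (TightSpan X) := ⋂ n ≥ 1, range (stageEmbed (X := X) n)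

end Sequence

/-! ### The trimming cylinder -/

section Cylinder

variable (X : Type u) [MetricSpace X]

/-- The vertices of the trimming cylinder: the disjoint union of the sets `X_k`, `k ≥ 0`. -/
abbrev Vertex : Type u := Σ k : ℕ, Stage X k

variable {X}

/-- The vertex `p_k(v) ∈ X_{k+1}` to which the edge `e_v` connects the vertex `v ∈ X_k`. -/
noncomputable def Vertex.next (v : Vertex X) : Vertex X := ⟨v.1 + 1, stageProj v.1 v.2⟩

/-- The length of the edge `e_v`: the value at `v ∈ X_k` of the function `underDist` of `X_k`. -/
noncomputable def Vertex.edgeLength (v : Vertex X) : ℝ := underDist v.2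

variable (X) in
/-- The set of points of the trimming cylinder `C`, a graph with vertices `v` and, for each vertex
`v`, an edge `e_v` from `v` to `v.next`. Every edge (also an edge of zero length, which in `C` is
still an arc) is parametrized proportionally to length by `[0, 1]`, from `v` at `0` to `v.next`
at `1`. As `C` is the disjoint union of the half-open edges `e_v \ {v.next}`, its points are the
pairs of a vertex `v` and a parameter in `[0, 1)`. -/
structure Cylinder where
  base : Vertex X
  param : ℝ
  param_mem : param ∈ Ico (0 : ℝ) 1

/-- A vertex as a point of the cylinder. -/
def Vertex.toCylinder (v : Vertex X) : Cylinder X := ⟨v, 0, le_rfl, zero_lt_one⟩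

/-- The inclusion `X = X_0 ⊆ C`. -/
def baseInclusion (x : X) : Cylinder X := Vertex.toCylinder ⟨0, x⟩

open Classical in
/-- The point with parameter `s ∈ [0, 1]` of the closed edge `e_v`. -/
noncomputable def edgePoint (v : Vertex X) (s : unitInterval) : Cylinder X :=
  if h : (s : ℝ) < 1 then ⟨v, s, s.2.1, h⟩ else v.next.toCylinder

/-- `IsPath a b ps es r`: the points `ps = [a = a_0, a_1, …, a_n = b]` form a path in the cylinder
in which the segment from `a_{i-1}` to `a_i` is contained in the `i`-th of the edges listed in `es`,
and the sum of the lengths of these segments is `r`. -/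
inductive IsPath : Cylinder X → Cylinder X → List (Cylinder X) → List (Vertex X) → ℝ → Prop
  | nil (a : Cylinder X) : IsPath a a [a] [] 0
  | cons {a b c : Cylinder X} {ps : List (Cylinder X)} {es : List (Vertex X)} {r : ℝ}
      (v : Vertex X) (s t : unitInterval) (ha : a = edgePoint v s) (hb : b = edgePoint v t)
      (h : IsPath b c ps es r) :
      IsPath a c (a :: ps) (v :: es) (|(s : ℝ) - t| * v.edgeLength + r)

/-- There is an injective path from `a` to `b` of length `r`: the successive segments lie in
distinct edges and their endpoints are distinct (so that the segments meet only in common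
endpoints). For points `a, b` of the same component `L` of the cylinder, which is a tree, this says
that `r = d_L(a, b)`, where `d_L` is the path pseudometric of `L`. For points of different components
it never holds. -/
def IsInjectivePathLength (a b : Cylinder X) (r : ℝ) : Prop :=
  ∃ ps es, IsPath a b ps es r ∧ ps.Nodup ∧ es.Nodup

/-- A pseudometric in the cylinder that restricts to the metric of `X` in `X ⊆ C` and to the path
pseudometric in every component of `C`. -/
structure IsAdmissible (P : PseudoMetricSpace (Cylinder X)) : Prop where
  restrict : ∀ x y : X, dist (baseInclusion x) (baseInclusion y) = dist x y
  path : ∀ (a b : Cylinder X) (r : ℝ), IsInjectivePathLength a b r → dist a b = r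

/-- `P` is the minimal admissible pseudometric `ρ` in the cylinder. -/
structure IsCylinderPseudometric (P : PseudoMetricSpace (Cylinder X)) : Prop where
  admissible : IsAdmissible P
  minimal : ∀ P' : PseudoMetricSpace (Cylinder X), IsAdmissible P' →
    ∀ a b : Cylinder X, P.dist a b ≤ P'.dist a b

/-- A vertex `v` of the cylinder is special if the edges `e_v, e_{v.next}, e_{v.next.next}, …` all
have zero length. A component of the cylinder is special if it has a special vertex. -/
def Vertex.IsSpecial (v : Vertex X) : Prop := ∀ n : ℕ, (Vertex.next^[n] v).edgeLength = 0

variable (X) in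
/-- The set of the roots of the special components, in the metric quotient of the cylinder: the root
of a special component is the common image of all its special vertices. -/
def roots [PseudoMetricSpace (Cylinder X)] : Set (SeparationQuotient (Cylinder X)) :=
  {c | ∃ v : Vertex X, v.IsSpecial ∧ c = SeparationQuotient.mk v.toCylinder}

end Cylinder

end TightSpanTrimming

open TightSpanTrimming

namespace TightSpanTrimming

universe w

/-! ### The tight span -/

namespace TightSpan

variable {X : Type w} [MetricSpace X]

/-! The cylinder is mapped to the tight span, and ρ is the pseudometric pulled back along this map.
The point with parameter s of the edge at `v` becomes the function with value s·`underDist v` at `v`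
and d(v, x) - s·`underDist v` at x ≠ v (`edgeFun`); it belongs to T(X) because `underDist` is
bounded by Gromov products. For s = 1 it is the image of the distance function of p(v) under T(t(X))
→ T(X), so the edges of all levels fit together to `cylinderFun`.

The pullback is admissible. On X it is the Kuratowski embedding. The length of a path bounds the
distance of its ends. An injective path never descends and then climbs, and two points of X whose
branches meet at a vertex are exactly as far apart as the path through that vertex is long; so
evaluation at a point of X below one end shows that the length is attained (`isPath_dichotomy`).

The pullback is minimal. Every admissible P has P(x, a) = f_a(x) for x below a, and d_T(f_a, f_b) is
at most |f_a(x) - f_b(x)| or d(x, y) - f_a(x) - f_b(y) for suitable x, y below a, b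
(`dist_cylinderFun_le`); both are at most P(a, b) by the triangle inequality.

For the decomposition, a function f ≥ `underDist` comes from T(t(X)) (`exists_trimEmbed_eq`), and
f(v) < `underDist v` forces f onto the edge of `v` (`eq_edgeFun_of_lt`). This is applied at the
first level where f leaves the filtration. Conversely, a point of an edge other than its tip comes
from the next level only if the edge has length zero, which leads to special vertices. -/

theorem abs_sub_le_dist (f g : TightSpan X) (x : X) : |f x - g x| ≤ dist f g :=
  le_ciSup (bddAbove_abs_sub f g) x

theorem dist_le_of_forall {f g : TightSpan X} {c : ℝ} (x₀ : X) (h : ∀ x, |f x - g x| ≤ c) :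
    dist f g ≤ c :=
  haveI : Nonempty X := ⟨x₀⟩
  ciSup_le h

theorem ofConditions_apply {f : X → ℝ} {h0 h1 h2} (x : X) :
    (ofConditions f h0 h1 h2 : TightSpan X) x = f x := rfl

theorem trimEmbed_apply (g : TightSpan (Trim X)) (x : X) :
    trimEmbed g x = g (Trim.proj x) + underDist x := rfl

/-! ### Edges of the cylinder as segments in the tight span -/

theorem underDist_le_dist {x y : X} (h : x ≠ y) : underDist x ≤ dist x y := by
  linarith [underDist_add_le h, underDist_nonneg y]

theorem mul_underDist_nonneg (v : X) (s : unitInterval) : 0 ≤ s * underDist v :=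
  mul_nonneg s.2.1 (underDist_nonneg v)

theorem mul_underDist_le (v : X) (s : unitInterval) : s * underDist v ≤ underDist v :=
  mul_le_of_le_one_left (underDist_nonneg v) s.2.2

open Classical in
/-- The function in the tight span that represents the point with parameter `s` of the edge from
`v` to its trimming projection. -/
noncomputable def edgeFun (v : X) (s : unitInterval) : TightSpan X :=
  TightSpan.ofConditions
    (fun x => if x = v then s * underDist v else dist v x - s * underDist v)
    (by
      intro x
      have h0 := mul_underDist_nonneg v s
      have h1 := mul_underDist_le v s
      split_ifs with h
      · exact h0
      · linarith [underDist_le_dist (Ne.symm h)])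
    (by
      intro x y
      have h0 := mul_underDist_nonneg v s
      have h1 := mul_underDist_le v s
      by_cases hxy : x = y
      · subst hxy
        rw [dist_self]
        split_ifs with h
        · linarith
        · linarith [underDist_le_dist (Ne.symm h)]
      split_ifs with hx hy hy
      · exact absurd (hx.trans hy.symm) hxy
      · subst hx; linarith
      · subst hy; rw [dist_comm]; linarith
      · have h2 := underDist_le hx hy hxy
        unfold gromovProduct at h2
        linarith)
    (by
      intro x ε hε
      by_cases hx : x = v
      -- Any other point is an exact partner of `v`; if there is none, the edge has length zero.
      · by_cases hw : ∃ z, z ≠ v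
        · obtain ⟨z, hz⟩ := hw
          refine ⟨z, ?_⟩
          rw [if_pos hx, if_neg hz, hx]
          linarith
        · push Not at hw
          refine ⟨v, ?_⟩
          rw [hx, if_pos rfl, underDist_eq_zero hw, dist_self]
          linarith
      · refine ⟨v, ?_⟩
        rw [if_neg hx, if_pos rfl, dist_comm]
        linarith)

theorem edgeFun_self (v : X) (s : unitInterval) : edgeFun v s v = s * underDist v := if_pos rfl

theorem edgeFun_of_ne {v x : X} (h : x ≠ v) (s : unitInterval) :
    edgeFun v s x = dist v x - s * underDist v := if_neg h

theorem edgeFun_zero (v x : X) : edgeFun v 0 x = dist v x := by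
  by_cases h : x = v
  · rw [h, edgeFun_self]; simp
  · rw [edgeFun_of_ne h]; simp

theorem trimEmbed_edgeFun_zero (v : X) : trimEmbed (edgeFun (Trim.proj v) 0) = edgeFun v 1 := by
  refine ext_fun fun x => ?_
  rw [trimEmbed_apply, edgeFun_zero, Trim.dist_proj]
  by_cases h : x = v
  · rw [h, edgeFun_self, trimDist_self]; simp
  · rw [edgeFun_of_ne h, trimDist_of_ne (Ne.symm h)]; simp

theorem edgeFun_congr {v : X} (h : underDist v = 0) (s t : unitInterval) :
    edgeFun v s = edgeFun v t := by
  refine ext_fun fun x => ?_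
  by_cases hx : x = v
  · rw [hx, edgeFun_self, edgeFun_self, h]; simp
  · rw [edgeFun_of_ne hx, edgeFun_of_ne hx, h]; simp

theorem abs_edgeFun_sub_edgeFun (v : X) (s t : unitInterval) (x : X) :
    |edgeFun v s x - edgeFun v t x| = |(s : ℝ) - t| * underDist v := by
  have h : |(s : ℝ) - t| * underDist v = |((s : ℝ) - t) * underDist v| := by
    rw [abs_mul, abs_of_nonneg (underDist_nonneg v)]
  rw [h]
  by_cases hx : x = v
  · rw [hx, edgeFun_self, edgeFun_self, sub_mul]
  · rw [edgeFun_of_ne hx, edgeFun_of_ne hx, ← abs_neg]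
    congr 1; ring

theorem abs_edgeFun_sub_edgeFun_le {v w : X} (hvw : v ≠ w) (s t : unitInterval) (x : X) :
    |edgeFun v s x - edgeFun w t x| ≤ dist v w - s * underDist v - t * underDist w := by
  have hv0 := mul_underDist_nonneg v s
  have hv1 := mul_underDist_le v s
  have hw0 := mul_underDist_nonneg w t
  have hw1 := mul_underDist_le w t
  have hd := underDist_add_le hvw
  rw [abs_le]
  by_cases hxv : x = v
  · subst hxv
    rw [edgeFun_self, edgeFun_of_ne hvw, dist_comm w x]
    constructor <;> linarith
  by_cases hxw : x = w
  · subst hxw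
    rw [edgeFun_self, edgeFun_of_ne hxv]
    constructor <;> linarith
  rw [edgeFun_of_ne hxv, edgeFun_of_ne hxw]
  -- The Gromov products at `v` and `w` give the two signs: each absorbs twice one of the two edge
  -- parameters.
  have h1 := underDist_le (Ne.symm hvw) hxv (Ne.symm hxw)
  have h2 := underDist_le hvw hxw (Ne.symm hxv)
  unfold gromovProduct at h1 h2
  rw [dist_comm w v] at h2
  constructor <;> linarith

/-! ### The image of T(t(X)) in T(X) and its complement -/

theorem exists_trimEmbed_eq (f : TightSpan X) (hf : ∀ x, underDist x ≤ f x) :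
    ∃ g, trimEmbed g = f := by
  -- Subtracting `underDist` preserves the conditions of the tight span, with `trimDist` in place of
  -- `dist`. The difference is therefore 1-Lipschitz for `trimDist` and descends to the quotient.
  have hle : ∀ x y, trimDist x y ≤ (f x - underDist x) + (f y - underDist y) := by
    intro x y
    by_cases h : x = y
    · rw [h, trimDist_self]; linarith [hf y]
    · rw [trimDist_of_ne h]; linarith [f.dist_le_add x y]
  have hex : ∀ x (ε : ℝ), 0 < ε → ∃ y,
      (f x - underDist x) + (f y - underDist y) ≤ trimDist x y + ε := by
    intro x ε hε
    obtain ⟨y, hy⟩ := f.exists_add_le x hε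
    by_cases h : x = y
    · subst h
      rw [dist_self] at hy
      exact ⟨x, by rw [trimDist_self]; linarith [underDist_nonneg x]⟩
    · exact ⟨y, by rw [trimDist_of_ne h]; linarith⟩
  have hlip : ∀ x y, f x - underDist x ≤ trimDist x y + (f y - underDist y) := by
    intro x y
    refine le_of_forall_pos_le_add fun ε hε => ?_
    obtain ⟨z, hz⟩ := hex x ε hε
    linarith [hle y z, trimDist_triangle x y z]
  let g : Trim X → ℝ := fun q => f (Trim.proj_surjective q).choose -
    underDist (Trim.proj_surjective q).choose
  have hg : ∀ x, g (Trim.proj x) = f x - underDist x := by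
    intro x
    have h1 := (Trim.proj_surjective (Trim.proj x)).choose_spec
    have h2 : trimDist (Trim.proj_surjective (Trim.proj x)).choose x = 0 := by
      rw [← Trim.dist_proj, h1, dist_self]
    have h3 := hlip (Trim.proj_surjective (Trim.proj x)).choose x
    have h4 := hlip x (Trim.proj_surjective (Trim.proj x)).choose
    rw [trimDist_comm] at h4
    show f _ - underDist _ = _
    linarith
  refine ⟨ofConditions g ?_ ?_ ?_, ext_fun fun x => ?_⟩
  · intro q
    obtain ⟨x, rfl⟩ := Trim.proj_surjective q
    rw [hg]; linarith [hf x]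
  · intro q q'
    obtain ⟨x, rfl⟩ := Trim.proj_surjective q
    obtain ⟨y, rfl⟩ := Trim.proj_surjective q'
    rw [hg, hg, Trim.dist_proj]; exact hle x y
  · intro q ε hε
    obtain ⟨x, rfl⟩ := Trim.proj_surjective q
    obtain ⟨y, hy⟩ := hex x ε hε
    exact ⟨Trim.proj y, by rwa [hg, hg, Trim.dist_proj]⟩
  · rw [trimEmbed_apply, ofConditions_apply, hg]; ring

/-- The value at `v` determines f: each x ≠ v must have `v` as its partner. A partner z of x other
than x and `v` would, by the Gromov product at `v`, make f(x) too small for d(v, x) ≤ f(v) + f(x).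
-/
theorem eq_edgeFun_of_lt (f : TightSpan X) {v : X} (hv : f v < underDist v) :
    ∃ s : unitInterval, (s : ℝ) < 1 ∧ f = edgeFun v s := by
  have h0 := f.nonneg' v
  have hpos : 0 < underDist v := h0.trans_lt hv
  have hs : f v / underDist v < 1 := (div_lt_one hpos).2 hv
  refine ⟨⟨f v / underDist v, div_nonneg h0 hpos.le, hs.le⟩, hs, ext_fun fun x => ?_⟩
  have hmul : f v / underDist v * underDist v = f v := div_mul_cancel₀ _ hpos.ne'
  by_cases hx : x = v
  · rw [hx, edgeFun_self]; exact hmul.symm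
  rw [edgeFun_of_ne hx]
  show f x = dist v x - f v / underDist v * underDist v
  rw [hmul]
  refine le_antisymm ?_ (by linarith [f.dist_le_add v x])
  refine le_of_forall_pos_le_add fun ε hε => ?_
  have hvx := underDist_le_dist (Ne.symm hx)
  -- The tolerance `underDist v - f v` is what the cases z = x and z ∉ {x, v} can afford; ε is
  -- needed for z = v.
  obtain ⟨z, hz⟩ := f.exists_add_le x (lt_min hε (sub_pos.2 hv))
  have hm1 := min_le_left ε (underDist v - f v)
  have hm2 := min_le_right ε (underDist v - f v)
  by_cases hzv : z = v
  · subst hzv; rw [dist_comm] at hz; linarith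
  by_cases hzx : z = x
  · subst hzx
    rw [dist_self] at hz
    linarith [f.dist_le_add v z, f.nonneg' z]
  have h1 := underDist_le hx hzv (Ne.symm hzx)
  unfold gromovProduct at h1
  linarith [f.dist_le_add v z]

end TightSpan

open TightSpan

/-! ### The trimming sequence -/

section Sequence

variable {X : Type w} [MetricSpace X]

/-- The projection `X → X_k`. -/
noncomputable def stageMap : (k : ℕ) → X → Stage X k
  | 0 => fun x => x
  | k + 1 => fun x => stageProj k (stageMap k x)

/-- The length of the path in the trimming cylinder from `x ∈ X` to its image in `X_k`. -/
noncomputable def height : ℕ → X → ℝ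
  | 0 => fun _ => 0
  | k + 1 => fun x => height k x + underDist (stageMap k x)

theorem stageMap_surjective : ∀ k, Function.Surjective (stageMap k : X → Stage X k)
  | 0 => Function.surjective_id
  | k + 1 => (Trim.proj_surjective (X := Stage X k)).comp (stageMap_surjective k)

theorem dist_stageProj (k : ℕ) (v v' : Stage X k) :
    dist (stageProj k v) (stageProj k v') = trimDist v v' :=
  Trim.dist_proj v v'

/-- The canonical embedding `T(X_{k+1}) → T(X_k)`. -/
noncomputable def stageTrimEmbed (k : ℕ) (g : TightSpan (Stage X (k + 1))) :
    TightSpan (Stage X k) :=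
  trimEmbed (X := Stage X k) (show TightSpan (Trim (Stage X k)) from g)

theorem stageTrimEmbed_apply (k : ℕ) (g : TightSpan (Stage X (k + 1))) (v : Stage X k) :
    stageTrimEmbed k g v = g (stageProj k v) + underDist v := rfl

theorem stageEmbed_succ (k : ℕ) (g : TightSpan (Stage X (k + 1))) :
    stageEmbed (k + 1) g = stageEmbed k (stageTrimEmbed k g) := rfl

theorem stageEmbed_apply : ∀ (k : ℕ) (g : TightSpan (Stage X k)) (x : X),
    stageEmbed k g x = g (stageMap k x) + height k x
  | 0, g, x => (add_zero (g x)).symm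
  | k + 1, g, x => by
    rw [stageEmbed_succ, stageEmbed_apply k, stageTrimEmbed_apply, add_right_comm, add_assoc]
    rfl

theorem stageEmbed_injective (k : ℕ) :
    Function.Injective (stageEmbed (X := X) k) := by
  intro f g h
  refine ext_fun fun v => ?_
  obtain ⟨x, rfl⟩ := stageMap_surjective k v
  have h1 := stageEmbed_apply k f x
  rw [h, stageEmbed_apply] at h1
  linarith

/-- While the images stay distinct, each trimming removes exactly the two edge lengths. -/
theorem dist_eq_height_add : ∀ (k : ℕ) {x y : X}, stageMap k x ≠ stageMap k y →
    dist x y = height k x + height k y + dist (stageMap k x) (stageMap k y)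
  | 0, x, y, _ => by
    show dist x y = 0 + 0 + dist x y
    ring
  | k + 1, x, y, h => by
    have hk : stageMap k x ≠ stageMap k y := fun e => h (congrArg (stageProj k) e)
    rw [dist_eq_height_add k hk]
    show _ = (height k x + underDist (stageMap k x)) + (height k y + underDist (stageMap k y)) +
      dist (stageProj k (stageMap k x)) (stageProj k (stageMap k y))
    rw [dist_stageProj, trimDist_of_ne hk]
    ring

/-- Points first identified at level k + 1 have trimmed distance zero there, so d is the length of
the path through their meeting vertex. -/
theorem dist_eq_height_succ_add {k : ℕ} {x y : X} (h : stageMap k x ≠ stageMap k y)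
    (h' : stageMap (k + 1) x = stageMap (k + 1) y) :
    dist x y = height (k + 1) x + height (k + 1) y := by
  have h1 : dist (stageProj k (stageMap k x)) (stageProj k (stageMap k y)) = 0 :=
    dist_eq_zero.2 h'
  rw [dist_stageProj, trimDist_of_ne h] at h1
  rw [dist_eq_height_add k h]
  show _ = (height k x + underDist (stageMap k x)) + (height k y + underDist (stageMap k y))
  linarith

theorem range_stageEmbed_succ_subset (n : ℕ) :
    range (stageEmbed (X := X) (n + 1)) ⊆ range (stageEmbed (X := X) n) := by
  rintro _ ⟨g, rfl⟩
  exact ⟨_, rfl⟩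

theorem range_stageEmbed_antitone : Antitone fun n => range (stageEmbed (X := X) n) :=
  antitone_nat_of_succ_le range_stageEmbed_succ_subset

theorem mem_tau_iff (f : TightSpan X) : f ∈ tau X ↔ ∀ n, f ∈ range (stageEmbed (X := X) n) := by
  simp only [tau, mem_iInter]
  refine ⟨fun h n => range_stageEmbed_antitone n.le_succ (h (n + 1) (by omega)), fun h n _ => h n⟩

end Sequence

/-! ### The map from the trimming cylinder to the tight span -/

section Cylinder

variable {X : Type w} [MetricSpace X]

/-- The image in `X_k` of a point of `X`, as a vertex of the cylinder. -/
noncomputable def stageVertex (k : ℕ) (x : X) : Vertex X := ⟨k, stageMap k x⟩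

theorem stageVertex_succ (k : ℕ) (x : X) : stageVertex (k + 1) x = (stageVertex k x).next := rfl

theorem exists_stageVertex_eq (v : Vertex X) : ∃ x, v = stageVertex v.1 x := by
  obtain ⟨x, hx⟩ := stageMap_surjective v.1 v.2
  exact ⟨x, by rw [stageVertex, hx]⟩

theorem edgeLength_stageVertex (k : ℕ) (x : X) :
    (stageVertex k x).edgeLength = underDist (stageMap k x) := rfl

theorem edgeLength_nonneg (v : Vertex X) : 0 ≤ v.edgeLength := underDist_nonneg v.2

theorem height_succ (k : ℕ) (x : X) :
    height (k + 1) x = height k x + (stageVertex k x).edgeLength := rfl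

/-- The function in the tight span that represents the point with parameter `s` of the edge
`e_v`. -/
noncomputable def vertexFun (v : Vertex X) (s : unitInterval) : TightSpan X :=
  stageEmbed v.1 (edgeFun v.2 s)

/-- Consecutive edges agree at their common vertex. -/
theorem vertexFun_one (v : Vertex X) : vertexFun v 1 = vertexFun v.next 0 := by
  have h := trimEmbed_edgeFun_zero v.2
  show stageEmbed v.1 (edgeFun v.2 1) = _
  rw [← h]
  rfl

/-- The function `x ↦ ρ(x, a)` in the tight span. -/
noncomputable def cylinderFun (a : Cylinder X) : TightSpan X :=
  vertexFun a.base ⟨a.param, a.param_mem.1, a.param_mem.2.le⟩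

theorem cylinderFun_edgePoint (v : Vertex X) (s : unitInterval) :
    cylinderFun (edgePoint v s) = vertexFun v s := by
  unfold edgePoint
  split_ifs with h
  · rfl
  · have hs : s = 1 := Subtype.ext (le_antisymm s.2.2 (not_lt.1 h))
    rw [hs, vertexFun_one]
    rfl

theorem edgePoint_of_lt (v : Vertex X) (s : unitInterval) (h : (s : ℝ) < 1) :
    edgePoint v s = ⟨v, s, s.2.1, h⟩ := dif_pos h

theorem edgePoint_one (v : Vertex X) : edgePoint v 1 = v.next.toCylinder :=
  dif_neg (by simp)

theorem edgePoint_zero (v : Vertex X) : edgePoint v 0 = v.toCylinder :=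
  dif_pos (by simp)

theorem vertexFun_stageVertex (k : ℕ) (x : X) (s : unitInterval) :
    vertexFun (stageVertex k x) s x = height k x + s * (stageVertex k x).edgeLength := by
  rw [vertexFun]
  refine (stageEmbed_apply k (edgeFun (stageMap k x) s) x).trans ?_
  rw [edgeFun_self, add_comm]
  rfl

theorem cylinderFun_baseInclusion (x y : X) : cylinderFun (baseInclusion x) y = dist x y :=
  edgeFun_zero x y

theorem dist_cylinderFun_baseInclusion (x : X) (f : TightSpan X) :
    dist (cylinderFun (baseInclusion x)) f = f x := by
  refine le_antisymm (dist_le_of_forall x fun y => ?_) ?_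
  · rw [cylinderFun_baseInclusion, abs_le]
    have h1 := f.dist_le_add x y
    have h2 := f.le_dist_add y x
    rw [dist_comm y x] at h2
    constructor <;> linarith
  · have h := abs_sub_le_dist (cylinderFun (baseInclusion x)) f x
    rwa [cylinderFun_baseInclusion, dist_self, zero_sub, abs_neg, abs_of_nonneg (f.nonneg' x)] at h

/-! ### Distances between points of the cylinder in the tight span -/

theorem dist_vertexFun (v : Vertex X) (s t : unitInterval) :
    dist (vertexFun v s) (vertexFun v t) = |(s : ℝ) - t| * v.edgeLength := by
  have h : ∀ x, |vertexFun v s x - vertexFun v t x| = |(s : ℝ) - t| * v.edgeLength := by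
    intro x
    rw [vertexFun, vertexFun, stageEmbed_apply, stageEmbed_apply, add_sub_add_right_eq_sub]
    exact abs_edgeFun_sub_edgeFun v.2 s t _
  obtain ⟨x, -⟩ := exists_stageVertex_eq v
  exact le_antisymm (dist_le_of_forall x fun y => (h y).le)
    ((h x).symm.le.trans (abs_sub_le_dist _ _ x))

theorem dist_vertexFun_le_of_ne {k : ℕ} {x y : X} (h : stageMap k x ≠ stageMap k y)
    (s t : unitInterval) :
    dist (vertexFun (stageVertex k x) s) (vertexFun (stageVertex k y) t) ≤
      dist x y - vertexFun (stageVertex k x) s x - vertexFun (stageVertex k y) t y := by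
  refine dist_le_of_forall x fun z => ?_
  rw [vertexFun_stageVertex, vertexFun_stageVertex, dist_eq_height_add k h]
  have h1 := abs_edgeFun_sub_edgeFun_le h s t (stageMap k z)
  have h2 := stageEmbed_apply k (edgeFun (stageMap k x) s) z
  have h3 := stageEmbed_apply k (edgeFun (stageMap k y) t) z
  have h4 : vertexFun (stageVertex k x) s z - vertexFun (stageVertex k y) t z =
      edgeFun (stageMap k x) s (stageMap k z) - edgeFun (stageMap k y) t (stageMap k z) := by
    show stageEmbed k (edgeFun (stageMap k x) s) z - stageEmbed k (edgeFun (stageMap k y) t) z = _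
    linarith
  rw [h4]
  rw [edgeLength_stageVertex, edgeLength_stageVertex]
  linarith

theorem dist_vertexFun_stageVertex_le (k n : ℕ) (x : X) :
    dist (vertexFun (stageVertex k x) 0) (vertexFun (stageVertex (k + n) x) 0) ≤
      height (k + n) x - height k x := by
  induction n with
  | zero => simp
  | succ n ih =>
    have h1 := dist_vertexFun (stageVertex (k + n) x) 0 1
    rw [vertexFun_one, ← stageVertex_succ] at h1
    have h2 := dist_triangle (vertexFun (stageVertex k x) 0) (vertexFun (stageVertex (k + n) x) 0)
      (vertexFun (stageVertex (k + n + 1) x) 0)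
    have h3 := height_succ (k + n) x
    simp only [Icc.coe_zero, Icc.coe_one, zero_sub, abs_neg, abs_one,
      one_mul] at h1
    rw [← add_assoc]
    linarith

theorem dist_vertexFun_vertex_le_of_lt {k m : ℕ} (h : k < m) (x : X) (s : unitInterval) :
    dist (vertexFun (stageVertex k x) s) (vertexFun (stageVertex m x) 0) ≤
      height m x - vertexFun (stageVertex k x) s x := by
  obtain ⟨n, rfl⟩ := Nat.exists_eq_add_of_le h
  have h1 := dist_vertexFun (stageVertex k x) s 1
  rw [vertexFun_one, ← stageVertex_succ, abs_sub_comm, Icc.coe_one,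
    abs_of_nonneg (sub_nonneg.2 s.2.2)] at h1
  have h2 := dist_vertexFun_stageVertex_le (k + 1) n x
  have h3 := dist_triangle (vertexFun (stageVertex k x) s) (vertexFun (stageVertex (k + 1) x) 0)
      (vertexFun (stageVertex (k + 1 + n) x) 0)
  have h4 := height_succ k x
  rw [vertexFun_stageVertex]
  linarith

/-- The point `x ∈ X` is a descendant of the vertex `a.base`. -/
def IsUnder (x : X) (a : Cylinder X) : Prop := a.base = stageVertex a.base.1 x

theorem exists_isUnder (a : Cylinder X) : ∃ x, IsUnder x a := exists_stageVertex_eq a.base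

/-- The distance of two points of the cylinder in the tight span is bounded in terms of the
distances to points of `X` below them. -/
theorem dist_cylinderFun_le_aux {a b : Cylinder X} (hab : a.base.1 ≤ b.base.1) :
    (∃ x, IsUnder x a ∧ IsUnder x b ∧
      dist (cylinderFun a) (cylinderFun b) ≤ |cylinderFun a x - cylinderFun b x|) ∨
    ∃ x y, IsUnder x a ∧ IsUnder y b ∧
      dist (cylinderFun a) (cylinderFun b) ≤ dist x y - cylinderFun a x - cylinderFun b y := by
  obtain ⟨x, hx⟩ := exists_isUnder a
  obtain ⟨y, hy⟩ := exists_isUnder b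
  have hx' := hx
  have hy' := hy
  unfold IsUnder at hx hy
  unfold cylinderFun
  generalize (⟨a.param, a.param_mem.1, a.param_mem.2.le⟩ : unitInterval) = s
  generalize (⟨b.param, b.param_mem.1, b.param_mem.2.le⟩ : unitInterval) = t
  rw [hx, hy]
  generalize hk : a.base.1 = k at *
  generalize hm : b.base.1 = m at *
  -- At the higher level `m`, either `a` lies on or below the edge of `b`, or the two branches are
  -- still apart and distinct vertices of X_m can be compared.
  by_cases hxy : stageMap m x = stageMap m y
  · left
    have hv : stageVertex m y = stageVertex m x := by rw [stageVertex, stageVertex, hxy]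
    refine ⟨x, hx', ?_, ?_⟩
    · show b.base = stageVertex b.base.1 x
      rw [hm, hy, hv]
    rw [hv]
    rcases hab.eq_or_lt with rfl | hlt
    · rw [dist_vertexFun, vertexFun_stageVertex, vertexFun_stageVertex, add_sub_add_left_eq_sub,
        ← sub_mul, abs_mul, abs_of_nonneg (edgeLength_nonneg (stageVertex k x))]
    · have h1 := dist_vertexFun_vertex_le_of_lt hlt x s
      have h2 := dist_vertexFun (stageVertex m x) 0 t
      have h3 := dist_triangle (vertexFun (stageVertex k x) s) (vertexFun (stageVertex m x) 0)
        (vertexFun (stageVertex m x) t)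
      have h4 := vertexFun_stageVertex m x t
      rw [Icc.coe_zero, zero_sub, abs_neg, abs_of_nonneg t.2.1] at h2
      rw [abs_sub_comm]
      refine le_trans ?_ (le_abs_self _)
      linarith
  · right
    refine ⟨x, y, hx', hy', ?_⟩
    rcases hab.eq_or_lt with rfl | hlt
    · exact dist_vertexFun_le_of_ne hxy s t
    · have h1 := dist_vertexFun_vertex_le_of_lt hlt x s
      have h2 := dist_vertexFun_le_of_ne hxy 0 t
      have h3 := dist_triangle (vertexFun (stageVertex k x) s) (vertexFun (stageVertex m x) 0)
        (vertexFun (stageVertex m y) t)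
      have h4 := vertexFun_stageVertex m x 0
      rw [Icc.coe_zero, zero_mul] at h4
      linarith

theorem dist_cylinderFun_le (a b : Cylinder X) :
    (∃ x, IsUnder x a ∧ IsUnder x b ∧
      dist (cylinderFun a) (cylinderFun b) ≤ |cylinderFun a x - cylinderFun b x|) ∨
    ∃ x y, IsUnder x a ∧ IsUnder y b ∧
      dist (cylinderFun a) (cylinderFun b) ≤ dist x y - cylinderFun a x - cylinderFun b y := by
  rcases le_total a.base.1 b.base.1 with h | h
  · exact dist_cylinderFun_le_aux h
  · rw [dist_comm]
    rcases dist_cylinderFun_le_aux h with ⟨x, hb, ha, hx⟩ | ⟨x, y, hb, ha, hx⟩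
    · exact Or.inl ⟨x, ha, hb, by rwa [abs_sub_comm]⟩
    · exact Or.inr ⟨y, x, ha, hb, by rw [dist_comm y x]; linarith⟩

/-! ### Paths in the cylinder -/

theorem dist_cylinderFun_le_of_isPath {a b : Cylinder X} {ps : List (Cylinder X)}
    {es : List (Vertex X)} {r : ℝ} (h : IsPath a b ps es r) :
    dist (cylinderFun a) (cylinderFun b) ≤ r := by
  induction h with
  | nil a => simp
  | @cons a b c ps es r v s t ha hb h ih =>
    have h1 := dist_vertexFun v s t
    rw [← cylinderFun_edgePoint, ← cylinderFun_edgePoint, ← ha, ← hb] at h1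
    linarith [dist_triangle (cylinderFun a) (cylinderFun b) (cylinderFun c)]

theorem IsPath.head_mem {a b : Cylinder X} {ps : List (Cylinder X)} {es : List (Vertex X)} {r : ℝ}
    (h : IsPath a b ps es r) : a ∈ ps := by
  cases h <;> simp

theorem isUnder_edgePoint_of_lt {x : X} {v : Vertex X} {s : unitInterval} (hs : (s : ℝ) < 1) :
    IsUnder x (edgePoint v s) ↔ v = stageVertex v.1 x := by
  rw [edgePoint_of_lt v s hs]
  rfl

theorem next_eq_stageVertex {x : X} {v : Vertex X} (h : v = stageVertex v.1 x) :
    v.next = stageVertex v.next.1 x := by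
  rw [h]
  rfl

theorem isUnder_edgePoint {x : X} {v : Vertex X} (h : v = stageVertex v.1 x) (s : unitInterval) :
    IsUnder x (edgePoint v s) := by
  by_cases hs : (s : ℝ) < 1
  · exact (isUnder_edgePoint_of_lt hs).2 h
  · rw [edgePoint, dif_neg hs]
    exact next_eq_stageVertex h

theorem cylinderFun_edgePoint_apply {x : X} {v : Vertex X} (h : v = stageVertex v.1 x)
    (s : unitInterval) :
    cylinderFun (edgePoint v s) x = height v.1 x + s * v.edgeLength := by
  rw [cylinderFun_edgePoint]
  have h1 := vertexFun_stageVertex v.1 x s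
  rwa [← h] at h1

theorem edgePoint_eq_edgePoint_of_lt {v v' : Vertex X} {s s' : unitInterval} (hs : (s : ℝ) < 1)
    (hs' : (s' : ℝ) < 1) (h : edgePoint v s = edgePoint v' s') : v = v' := by
  rw [edgePoint_of_lt v s hs, edgePoint_of_lt v' s' hs'] at h
  exact congrArg Cylinder.base h

theorem edgePoint_eq_next {v v' : Vertex X} {s : unitInterval} (hs : (s : ℝ) < 1)
    (h : edgePoint v s = edgePoint v' 1) : v = v'.next ∧ (s : ℝ) = 0 := by
  rw [edgePoint_of_lt v s hs, edgePoint_one] at h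
  exact ⟨congrArg Cylinder.base h, congrArg Cylinder.param h⟩

theorem eq_one_of_not_lt {s : unitInterval} (h : ¬ (s : ℝ) < 1) : s = 1 :=
  Subtype.ext (le_antisymm s.2.2 (not_lt.1 h))

/-- For two distinct edges with a common tip, the tip minimizes the sum of the distances to a point of
`X` below one edge and a point below the other one. -/
theorem cylinderFun_add_le_of_next_eq {x y : X} {v v' : Vertex X} (hx : v = stageVertex v.1 x)
    (hy : v' = stageVertex v'.1 y) (hne : v ≠ v') (hnext : v.next = v'.next) (f : TightSpan X) :
    cylinderFun (edgePoint v 1) x + cylinderFun (edgePoint v 1) y ≤ f x + f y := by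
  have hy1 : cylinderFun (edgePoint v 1) y = cylinderFun (edgePoint v' 1) y := by
    rw [edgePoint_one, edgePoint_one, hnext]
  rw [hy1, cylinderFun_edgePoint_apply hx, cylinderFun_edgePoint_apply hy]
  have hk : v.1 = v'.1 := Nat.succ_injective (congrArg Sigma.fst hnext)
  rw [← hk] at hy ⊢
  have h1 : stageMap v.1 x ≠ stageMap v.1 y := fun e =>
    hne (by rw [hx, hy, stageVertex, stageVertex, e])
  have h2 : stageMap (v.1 + 1) x = stageMap (v.1 + 1) y := by
    have h3 : stageVertex (v.1 + 1) x = stageVertex (v.1 + 1) y := by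
      rw [stageVertex_succ, stageVertex_succ, ← hx, ← hy, hnext]
    exact eq_of_heq (Sigma.mk.inj h3).2
  have h3 := dist_eq_height_succ_add h1 h2
  rw [height_succ, height_succ, ← hx, ← hy] at h3
  have h4 := f.dist_le_add x y
  rw [Icc.coe_one]
  linarith

/-- The first alternative is a path that starts upwards (or is constant), the second one that
descends throughout. The clauses on the first edge and on the position of `a` exist for the
induction: they exclude a descent followed by a climb, and a turn inside an edge. -/
theorem isPath_dichotomy {a c : Cylinder X} {ps : List (Cylinder X)} {es : List (Vertex X)} {r : ℝ}
    (h : IsPath a c ps es r) (hps : ps.Nodup) (hes : es.Nodup) :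
    ((∀ v ∈ es.head?, ∃ s : unitInterval, (s : ℝ) < 1 ∧ a = edgePoint v s) ∧
      (es = [] → a = c) ∧
      ∀ x, IsUnder x a → cylinderFun a x + r ≤ cylinderFun c x) ∨
    ∃ (v : Vertex X) (s : unitInterval), v ∈ es ∧ 0 < (s : ℝ) ∧ a = edgePoint v s ∧
      ∀ y, IsUnder y c → v = stageVertex v.1 y ∧ cylinderFun c y + r ≤ cylinderFun a y := by
  induction h with
  | nil a =>
    left
    refine ⟨by simp, fun _ => rfl, fun x _ => by simp⟩
  | @cons a b c ps es r v s t ha hb h ih =>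
    rw [List.nodup_cons] at hps hes
    have hab : a ≠ b := fun e => hps.1 (e ▸ h.head_mem)
    have hst : (s : ℝ) ≠ t := fun e => hab (by rw [ha, hb, Subtype.ext e])
    rcases lt_or_gt_of_ne hst with hlt | hlt
    · left
      have hs : (s : ℝ) < 1 := hlt.trans_le t.2.2
      refine ⟨?_, by simp, ?_⟩
      · intro v' hv'
        simp only [List.head?_cons, Option.mem_def, Option.some.injEq] at hv'
        subst hv'
        exact ⟨s, hs, ha⟩
      intro x hx
      rw [ha, isUnder_edgePoint_of_lt hs] at hx
      have hxb : IsUnder x b := hb ▸ isUnder_edgePoint hx t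
      have e1 := cylinderFun_edgePoint_apply hx s
      have e2 := cylinderFun_edgePoint_apply hx t
      rw [← ha] at e1
      rw [← hb] at e2
      rw [abs_sub_comm, abs_of_pos (sub_pos.2 hlt)]
      rcases ih hps.2 hes.2 with ⟨-, -, hU⟩ | ⟨v', s', hv', hs'0, hb', hD⟩
      · linarith [hU x hxb]
      · have hne : v ≠ v' := fun e => hes.1 (e ▸ hv')
        have hbb : edgePoint v t = edgePoint v' s' := hb.symm.trans hb'
        by_cases ht : (t : ℝ) < 1
        -- A turn before the tip would reuse the edge `v`, or take place at the bottom of `v`, which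
        -- a climb cannot reach.
        · exfalso
          by_cases hs' : (s' : ℝ) < 1
          · exact hne (edgePoint_eq_edgePoint_of_lt ht hs' hbb)
          · rw [eq_one_of_not_lt hs'] at hbb
            linarith [(edgePoint_eq_next ht hbb).2, s.2.1]
        · have ht1 := eq_one_of_not_lt ht
          by_cases hs' : (s' : ℝ) < 1
          · rw [ht1] at hbb
            exact absurd (edgePoint_eq_next hs' hbb.symm).2 hs'0.ne'
          · rw [eq_one_of_not_lt hs', ht1, edgePoint_one, edgePoint_one] at hbb
            -- The path turns at the common tip b: the descent gives f_c(y) + r ≤ f_b(y), and f_b(x)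
            -- + f_b(y) ≤ f_c(x) + f_c(y) transfers this to x.
            obtain ⟨y, hy⟩ := exists_isUnder c
            obtain ⟨hyv', hyD⟩ := hD y hy
            have h5 := cylinderFun_add_le_of_next_eq hx hyv' hne (congrArg Cylinder.base hbb)
              (cylinderFun c)
            rw [← ht1, ← hb] at h5
            linarith
    · right
      refine ⟨v, s, by simp, t.2.1.trans_lt hlt, ha, fun y hy => ?_⟩
      have ht : (t : ℝ) < 1 := hlt.trans_le s.2.2
      suffices hyv : v = stageVertex v.1 y ∧ cylinderFun c y + r ≤ cylinderFun b y by
        refine ⟨hyv.1, ?_⟩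
        have e1 := cylinderFun_edgePoint_apply hyv.1 s
        have e2 := cylinderFun_edgePoint_apply hyv.1 t
        rw [← ha] at e1
        rw [← hb] at e2
        rw [abs_of_pos (sub_pos.2 hlt)]
        linarith [hyv.2]
      rcases ih hps.2 hes.2 with ⟨hhead, hnil, hU⟩ | ⟨v', s', hv', hs'0, hb', hD⟩
      · cases es with
        | nil =>
          have hbc := hnil rfl
          have hyb : IsUnder y b := hbc ▸ hy
          refine ⟨(isUnder_edgePoint_of_lt ht).1 (hb ▸ hyb), ?_⟩
          have := hU y hyb
          rw [hbc] at this ⊢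
          exact this
        | cons v' es =>
          -- Climbing after a descent would have to use the same edge again.
          obtain ⟨s', hs', hb'⟩ := hhead v' (by simp)
          have := edgePoint_eq_edgePoint_of_lt ht hs' (hb.symm.trans hb')
          exact absurd (by simp [this]) hes.1
      · obtain ⟨hyv', hyD⟩ := hD y hy
        refine ⟨?_, hyD⟩
        have hbb : edgePoint v t = edgePoint v' s' := hb.symm.trans hb'
        -- Two consecutive descents must meet at the tip of the lower edge.
        by_cases hs' : (s' : ℝ) < 1
        · exact absurd ((edgePoint_eq_edgePoint_of_lt ht hs' hbb) ▸ hv') hes.1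
        · rw [eq_one_of_not_lt hs'] at hbb
          rw [(edgePoint_eq_next ht hbb).1]
          exact next_eq_stageVertex hyv'

theorem dist_cylinderFun_eq_of_isInjectivePathLength {a b : Cylinder X} {r : ℝ}
    (h : IsInjectivePathLength a b r) : dist (cylinderFun a) (cylinderFun b) = r := by
  obtain ⟨ps, es, hp, hps, hes⟩ := h
  refine le_antisymm (dist_cylinderFun_le_of_isPath hp) ?_
  rcases isPath_dichotomy hp hps hes with ⟨-, -, hU⟩ | ⟨v, s, -, -, -, hD⟩
  · obtain ⟨x, hx⟩ := exists_isUnder a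
    have h1 := abs_sub_le_dist (cylinderFun a) (cylinderFun b) x
    linarith [hU x hx, neg_le_abs (cylinderFun a x - cylinderFun b x)]
  · obtain ⟨y, hy⟩ := exists_isUnder b
    have h1 := abs_sub_le_dist (cylinderFun a) (cylinderFun b) y
    linarith [(hD y hy).2, le_abs_self (cylinderFun a y - cylinderFun b y)]

/-! ### Vertical paths and minimality -/

theorem le_base_edgePoint (v : Vertex X) (s : unitInterval) : v.1 ≤ (edgePoint v s).base.1 := by
  unfold edgePoint
  split_ifs
  · exact le_rfl
  · exact Nat.le_succ v.1

/-- The level bounds keep the lists free of repetitions when a vertex and edge of lower level are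
prepended. For t = 0 the last segment would be degenerate. -/
theorem exists_vertical_path (x : X) (t : unitInterval) (ht : 0 < (t : ℝ)) (n k : ℕ) :
    ∃ ps es, IsPath (stageVertex k x).toCylinder (edgePoint (stageVertex (k + n) x) t) ps es
      (height (k + n) x + t * (stageVertex (k + n) x).edgeLength - height k x) ∧
      ps.Nodup ∧ es.Nodup ∧ (∀ p ∈ ps, k ≤ p.base.1) ∧ ∀ e ∈ es, k ≤ e.1 := by
  induction n generalizing k with
  | zero =>
    refine ⟨[(stageVertex k x).toCylinder, edgePoint (stageVertex k x) t], [stageVertex k x],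
      ?_, ?_, ?_, ?_, ?_⟩
    · have h := IsPath.cons (stageVertex k x) 0 t (edgePoint_zero _).symm rfl (IsPath.nil _)
      rw [Icc.coe_zero, zero_sub, abs_neg, abs_of_pos ht, add_zero] at h
      rw [Nat.add_zero, add_sub_cancel_left]
      exact h
    · rw [List.nodup_cons]
      refine ⟨?_, by simp⟩
      rw [List.mem_singleton]
      intro e
      by_cases h1 : (t : ℝ) < 1
      · rw [edgePoint_of_lt _ _ h1] at e
        exact ht.ne (congrArg Cylinder.param e)
      · rw [edgePoint, dif_neg h1] at e
        exact absurd (congrArg (fun p : Cylinder X => p.base.1) e) (Nat.succ_ne_self k).symm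
    · simp
    · intro p hp
      simp only [List.mem_cons, List.not_mem_nil, or_false] at hp
      rcases hp with rfl | rfl
      · exact le_rfl
      · exact le_base_edgePoint (stageVertex k x) t
    · intro e he
      rw [List.mem_singleton] at he
      rw [he]
      exact le_rfl
  | succ n ih =>
    obtain ⟨ps, es, hp, hps, hes, hps', hes'⟩ := ih (k + 1)
    refine ⟨(stageVertex k x).toCylinder :: ps, stageVertex k x :: es, ?_, ?_, ?_, ?_, ?_⟩
    · have h := IsPath.cons (stageVertex k x) 0 1 (edgePoint_zero _).symm (edgePoint_one _).symm hp
      rw [Icc.coe_zero, zero_sub, abs_neg, Icc.coe_one, abs_one, height_succ,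
        show k + 1 + n = k + (n + 1) by omega] at h
      convert h using 1
      ring
    · refine List.nodup_cons.2 ⟨fun h => ?_, hps⟩
      exact absurd (hps' _ h) (Nat.not_succ_le_self k)
    · refine List.nodup_cons.2 ⟨fun h => ?_, hes⟩
      exact absurd (hes' _ h) (Nat.not_succ_le_self k)
    · intro p hp
      rcases List.mem_cons.1 hp with rfl | hp
      · exact le_rfl
      · exact (Nat.le_succ k).trans (hps' p hp)
    · intro e he
      rcases List.mem_cons.1 he with rfl | he
      · exact le_rfl
      · exact (Nat.le_succ k).trans (hes' e he)

theorem isInjectivePathLength_edgePoint (x : X) (k : ℕ) (t : unitInterval) (ht : 0 < (t : ℝ)) :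
    IsInjectivePathLength (baseInclusion x) (edgePoint (stageVertex k x) t)
      (cylinderFun (edgePoint (stageVertex k x) t) x) := by
  obtain ⟨ps, es, hp, hps, hes, -, -⟩ := exists_vertical_path x t ht k 0
  refine ⟨ps, es, ?_, hps, hes⟩
  rw [cylinderFun_edgePoint, vertexFun_stageVertex]
  rw [Nat.zero_add, show height 0 x = 0 from rfl, sub_zero] at hp
  exact hp

theorem isInjectivePathLength_of_isUnder {x : X} {a : Cylinder X} (h : IsUnder x a) :
    IsInjectivePathLength (baseInclusion x) a (cylinderFun a x) := by
  obtain ⟨v, s, hs⟩ := a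
  change v = stageVertex v.1 x at h
  generalize v.1 = k at h
  subst h
  -- A vertex of positive level is reached as the tip (t = 1) of the edge below it; at level 0 the
  -- path is constant.
  rcases hs.1.eq_or_lt with h0 | h0
  · subst h0
    cases k with
    | zero =>
      refine ⟨[baseInclusion x], [], ?_, by simp, by simp⟩
      have h1 := IsPath.nil (baseInclusion x)
      have h2 : cylinderFun (baseInclusion x) x = 0 := by
        rw [cylinderFun_baseInclusion, dist_self]
      rw [← h2] at h1
      exact h1
    | succ k =>
      have h := isInjectivePathLength_edgePoint x k 1 (by simp)
      rw [edgePoint_one] at h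
      exact h
  · have h := isInjectivePathLength_edgePoint x k ⟨s, hs.1, hs.2.le⟩ h0
    rw [edgePoint_of_lt _ _ hs.2] at h
    exact h

theorem dist_cylinderFun_le_of_isAdmissible {P : PseudoMetricSpace (Cylinder X)}
    (hP : IsAdmissible P) (a b : Cylinder X) :
    dist (cylinderFun a) (cylinderFun b) ≤ P.dist a b := by
  have key : ∀ {x : X} {a : Cylinder X}, IsUnder x a →
      dist (baseInclusion x) a = cylinderFun a x := fun h =>
    hP.path _ _ _ (isInjectivePathLength_of_isUnder h)
  show _ ≤ dist a b
  rcases dist_cylinderFun_le a b with ⟨x, ha, hb, h⟩ | ⟨x, y, ha, hb, h⟩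
  · refine h.trans ?_
    rw [← key ha, ← key hb, dist_comm _ a, dist_comm _ b]
    exact abs_dist_sub_le a b _
  · have h1 := dist_triangle4 (baseInclusion x) a b (baseInclusion y)
    rw [hP.restrict, key ha, dist_comm b, key hb] at h1
    linarith

variable (X) in
/-- The minimal admissible pseudometric, induced from the tight span. -/
@[reducible]
noncomputable def cylinderPseudoMetric : PseudoMetricSpace (Cylinder X) :=
  PseudoMetricSpace.induced cylinderFun inferInstance

theorem isCylinderPseudometric_cylinderPseudoMetric :
    IsCylinderPseudometric (cylinderPseudoMetric X) where
  admissible :=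
    { restrict := fun x y =>
        (dist_cylinderFun_baseInclusion x _).trans
          ((cylinderFun_baseInclusion y x).trans (dist_comm y x))
      path := fun _ _ _ h => dist_cylinderFun_eq_of_isInjectivePathLength h }
  minimal := fun _ hP a b => dist_cylinderFun_le_of_isAdmissible hP a b

/-! ### The decomposition of the tight span -/

/-- At the last level k with f in T(X_k), the preimage of f falls below `underDist` at some vertex
and so lies on its edge. -/
theorem exists_cylinderFun_eq_of_notMem_tau {f : TightSpan X} (hf : f ∉ tau X) :
    ∃ a, cylinderFun a = f := by
  classical
  rw [mem_tau_iff, not_forall] at hf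
  have h0 : Nat.find hf ≠ 0 := fun h => by
    have h1 := Nat.find_spec hf
    rw [h] at h1
    exact h1 ⟨f, rfl⟩
  obtain ⟨k, hk⟩ := Nat.exists_eq_succ_of_ne_zero h0
  have h1 := Nat.find_spec hf
  have h2 := Nat.find_min hf (m := k) (by omega)
  rw [hk] at h1
  rw [not_not] at h2
  obtain ⟨g, rfl⟩ := h2
  have h3 : ¬ ∀ v, underDist v ≤ g v := fun h => by
    obtain ⟨g', hg'⟩ := exists_trimEmbed_eq g h
    exact h1 ⟨g', by rw [← hg']; rfl⟩
  push Not at h3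
  obtain ⟨v, hv⟩ := h3
  obtain ⟨s, -, rfl⟩ := eq_edgeFun_of_lt g hv
  exact ⟨edgePoint ⟨k, v⟩ s, cylinderFun_edgePoint _ _⟩

/-! ### Special vertices and τ -/

theorem iterate_next_fst (v : Vertex X) (n : ℕ) : (Vertex.next^[n] v).1 = v.1 + n := by
  induction n with
  | zero => rfl
  | succ n ih =>
    rw [Function.iterate_succ_apply']
    show (Vertex.next^[n] v).1 + 1 = _
    omega

theorem vertexFun_congr {v : Vertex X} (h : v.edgeLength = 0) (s t : unitInterval) :
    vertexFun v s = vertexFun v t :=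
  congrArg (stageEmbed v.1) (edgeFun_congr h s t)

/-- Functions from the next level are at least `underDist` at `v`, whereas the value here is
s·`underDist v` with s < 1. -/
theorem edgeLength_eq_zero_of_mem_tau {v : Vertex X} {s : unitInterval} (hs : (s : ℝ) < 1)
    (h : vertexFun v s ∈ tau X) : v.edgeLength = 0 := by
  rw [mem_tau_iff] at h
  obtain ⟨g, hg⟩ := h (v.1 + 1)
  have h1 : stageTrimEmbed v.1 g = edgeFun v.2 s := stageEmbed_injective v.1 hg
  have h2 : s * underDist v.2 = stageTrimEmbed v.1 g v.2 := by rw [h1, edgeFun_self]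
  rw [stageTrimEmbed_apply] at h2
  have h3 := g.nonneg' (stageProj v.1 v.2)
  have h4 : underDist v.2 ≤ s * underDist v.2 := by
    rw [h2]
    exact le_add_of_nonneg_left h3
  have h5 := underDist_nonneg v.2
  show underDist v.2 = 0
  nlinarith

theorem vertexFun_iterate_next {v : Vertex X} {n : ℕ}
    (h : ∀ m < n, (Vertex.next^[m] v).edgeLength = 0) :
    vertexFun (Vertex.next^[n] v) 0 = vertexFun v 0 := by
  induction n with
  | zero => rfl
  | succ n ih =>
    rw [Function.iterate_succ_apply', ← vertexFun_one, vertexFun_congr (h n n.lt_succ_self) 1 0]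
    exact ih fun m hm => h m (hm.trans n.lt_succ_self)

theorem isSpecial_of_mem_tau {v : Vertex X} (h : vertexFun v 0 ∈ tau X) : v.IsSpecial := by
  intro n
  induction n using Nat.strong_induction_on with
  | _ n ih =>
    refine edgeLength_eq_zero_of_mem_tau (s := 0) (by simp) ?_
    rwa [vertexFun_iterate_next ih]

theorem mem_tau_of_isSpecial {v : Vertex X} (h : v.IsSpecial) : vertexFun v 0 ∈ tau X := by
  rw [mem_tau_iff]
  intro n
  -- Moving up n edges of length zero does not change the function and brings it into T(X_j) with j
  -- ≥ n.
  rw [← vertexFun_iterate_next (n := n) fun m _ => h m]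
  refine range_stageEmbed_antitone (a := n) ?_ ⟨_, rfl⟩
  rw [iterate_next_fst]
  omega

theorem cylinderFun_toCylinder (v : Vertex X) : cylinderFun v.toCylinder = vertexFun v 0 := rfl

end Cylinder

end TightSpanTrimming

open TightSpanTrimming
theorem theorem8p1 (X : Type*) [MetricSpace X] :
    ∃ P : PseudoMetricSpace (Cylinder X), IsCylinderPseudometric P ∧
      ∃ ι : SeparationQuotient (Cylinder X) → TightSpan X,
        Isometry ι ∧
        (∀ (a : Cylinder X) (x : X), ι (SeparationQuotient.mk a) x = dist (baseInclusion x) a) ∧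
        tau X ∪ range ι = univ ∧
        tau X ∩ range ι = ι '' roots X := by
  refine ⟨cylinderPseudoMetric X, isCylinderPseudometric_cylinderPseudoMetric, ?_⟩
  let _ := cylinderPseudoMetric X
  have hdist : ∀ a b : Cylinder X, dist a b = dist (cylinderFun a) (cylinderFun b) :=
    fun _ _ => rfl
  let ι : SeparationQuotient (Cylinder X) → TightSpan X :=
    SeparationQuotient.lift cylinderFun fun a b h => by
      rw [Metric.inseparable_iff, hdist] at h
      exact dist_eq_zero.1 h
  have hι : ∀ a, ι (SeparationQuotient.mk a) = cylinderFun a := fun _ => rfl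
  refine ⟨ι, ?_, ?_, ?_, ?_⟩
  · refine Isometry.of_dist_eq fun p q => ?_
    obtain ⟨a, rfl⟩ := SeparationQuotient.surjective_mk p
    obtain ⟨b, rfl⟩ := SeparationQuotient.surjective_mk q
    rw [hι, hι, SeparationQuotient.dist_mk, hdist]
  · intro a x
    rw [hι, hdist, dist_cylinderFun_baseInclusion]
  · refine eq_univ_of_forall fun f => ?_
    by_cases hf : f ∈ tau X
    · exact Or.inl hf
    · obtain ⟨a, rfl⟩ := exists_cylinderFun_eq_of_notMem_tau hf
      exact Or.inr ⟨SeparationQuotient.mk a, hι a⟩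
  · ext f
    constructor
    · rintro ⟨hf, p, rfl⟩
      obtain ⟨a, rfl⟩ := SeparationQuotient.surjective_mk p
      rw [hι] at hf
      have h0 := edgeLength_eq_zero_of_mem_tau a.param_mem.2 hf
      -- The edge has length zero, so the point may be replaced by the base vertex.
      have h1 : cylinderFun a = vertexFun a.base 0 := vertexFun_congr h0 _ 0
      refine ⟨SeparationQuotient.mk a.base.toCylinder, ⟨a.base, ?_, rfl⟩, ?_⟩
      · rw [h1] at hf
        exact isSpecial_of_mem_tau hf
      · rw [hι, hι, h1, cylinderFun_toCylinder]
    · rintro ⟨_, ⟨v, hv, rfl⟩, rfl⟩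
      refine ⟨?_, _, rfl⟩
      rw [hι, cylinderFun_toCylinder]
      exact mem_tau_of_isSpecial hv
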